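/- Conventions. For sets or classes $X$, $\kappa_X$ is the least ordinal $\alpha\in X$ with $\alpha\nsubseteq X$ (if there is one). A set $x$ is bounded in $M$ if $x\subseteq y$ for some $y\in M$. A powerful model is a transitive set or class $\mathcal H$ such that $(\mathcal H,\in)$ is a model of a sufficiently strong fragment of ZFC (it is enough that $\omega\in\mathcal H$ and that $\mathcal H$ is closed under pairing, unions and cartesian products) and every set bounded in $\mathcal H$ belongs to $\mathcal H$. A set $x$ is $\delta$-approximated in $M$ if $x\cap a\in M$ for all $a\in M$ with $|a|^M<\delta$, and it is guessed in $M$ if $x^*\cap M=x\cap M$ for some $x^*\in M$. $M$ is a $\delta$-guessing elementary submodel if $\kappa_M$ exists, $\delta\in M$, $\delta\le\kappa_M$, $\delta$ is an infinite regular cardinal in $M$, $M\prec\mathcal H$ for some powerful model $\mathcal H$, and every set that is bounded and $\delta$-approximated in $M$ is guessed in $M$. $\mathcal P_\kappa(X)$ is the set of subsets of $X$ of size less than $\kappa$; $\mathcal S\subseteq\mathcal P_\kappa(X)$ is stationary if for every $F:\mathcal P_\omega(X)\to\mathcal P_\kappa(X)$ there is $A\in\mathcal S$ with $F(a)\subseteq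 A$ for all $a\in\mathcal P_\omega(A)$. ${\rm GMP}(\kappa,\delta)$ states that for all sufficiently large regular cardinals $\theta$ the set of those $M\in\mathcal P_\kappa(H_\theta)$ with $M\prec H_\theta$ that are $\delta$-guessing elementary submodels is stationary in $\mathcal P_\kappa(H_\theta)$. A $\kappa$-tree is a tree of height $\kappa$ all of whose levels have size less than $\kappa$; a $\kappa$-Aronszajn tree is a $\kappa$-tree without cofinal branches; ${\rm TP}(\kappa)$ (the tree property) states that there is no $\kappa$-Aronszajn tree. Theorem. (1) If $M$ is a $\kappa_M$-guessing elementary submodel, then there is no $\kappa_M$-Aronszajn tree $(T,<_T)\in M$. (2) For every infinite regular cardinal $\delta$, ${\rm GMP}(\delta,\delta)$ implies ${\rm TP}(\delta)$. (3) For every infinite regular cardinal $\delta$, ${\rm GMP}(\delta^+,\delta)$ implies ${\rm TP}(\delta^+)$. -/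

import Mathlib

universe u

namespace GuessingModels

open Cardinal

/-! The universe `V` of sets is `ZFSet.{u}`; a set or class `M` of sets is a `Set ZFSet.{u}`. -/

/-! ### Elementary submodels in the language of set theory -/

/-- The only non-logical symbol of the language of set theory: a binary relation. -/
inductive MemRel : ℕ → Type
  | mem : MemRel 2

/-- The first-order language of set theory. -/
def setLanguage : FirstOrder.Language.{0, 0} := ⟨fun _ => Empty, MemRel⟩

/-- The structure `(M, ∈)`. -/
instance memStructure (M : Set ZFSet.{u}) : setLanguage.Structure M where
  funMap := fun f => Empty.elim f
  RelMap := fun r => match r with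
    | MemRel.mem => fun v => (v 0 : ZFSet.{u}) ∈ (v 1 : ZFSet.{u})

/-- `M ≺ H`: `M ⊆ H`, and `(M, ∈)` and `(H, ∈)` satisfy the same formulas at tuples from `M`. -/
def IsElementarySubmodel (M H : Set ZFSet.{u}) : Prop :=
  ∃ h : M ⊆ H, ∀ (n : ℕ) (φ : setLanguage.Formula (Fin n)) (v : Fin n → M),
    φ.Realize (Set.inclusion h ∘ v) ↔ φ.Realize v

/-- `x` is bounded in `M`. -/
def IsBoundedIn (M : Set ZFSet.{u}) (x : ZFSet.{u}) : Prop := ∃ y ∈ M, x ⊆ y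

/-- A powerful model: a transitive model which contains every set bounded in it.
"Model" means model of a sufficiently strong fragment of ZFC. Only the axioms of infinity, pairing,
union and existence of cartesian products are asked for here (extensionality, foundation, separation
and choice are automatic for a transitive class that contains all subsets of its elements), so that
every transitive model of a larger fragment, with all its bounded sets, is covered. -/
structure IsPowerful (H : Set ZFSet.{u}) : Prop where
  transitive : ∀ x ∈ H, ∀ y ∈ x, y ∈ H
  omega_mem : ZFSet.omega ∈ H
  pairing : ∀ x ∈ H, ∀ y ∈ H, ({x, y} : ZFSet.{u}) ∈ H
  union : ∀ x ∈ H, (ZFSet.sUnion x) ∈ H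
  product : ∀ x ∈ H, ∀ y ∈ H, ZFSet.prod x y ∈ H
  bounded_mem : ∀ x, IsBoundedIn H x → x ∈ H

/-! ### Notions relativized to `M` (all quantifiers range over `M`) -/

/-- `M ⊨ p = (x, y)` (Kuratowski pair `{{x}, {x, y}}`). -/
def IsPairIn (M : Set ZFSet.{u}) (p x y : ZFSet.{u}) : Prop :=
  ∀ z ∈ M, z ∈ p ↔ ((∀ w ∈ M, w ∈ z ↔ w = x) ∨ (∀ w ∈ M, w ∈ z ↔ (w = x ∨ w = y)))

/-- `M ⊨ (x, y) ∈ f`. -/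
def PairMemIn (M : Set ZFSet.{u}) (f x y : ZFSet.{u}) : Prop :=
  ∃ p ∈ M, p ∈ f ∧ IsPairIn M p x y

/-- `M ⊨ f` is a function from `a` to `b`. -/
def IsFunctionIn (M : Set ZFSet.{u}) (f a b : ZFSet.{u}) : Prop :=
  (∀ p ∈ M, p ∈ f → ∃ x ∈ M, x ∈ a ∧ ∃ y ∈ M, y ∈ b ∧ IsPairIn M p x y) ∧
  ∀ x ∈ M, x ∈ a → ∃ y ∈ M, PairMemIn M f x y ∧ ∀ y' ∈ M, PairMemIn M f x y' → y' = y

/-- `M ⊨ f` is an injective function from `a` to `b`. -/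
def IsInjectionIn (M : Set ZFSet.{u}) (f a b : ZFSet.{u}) : Prop :=
  IsFunctionIn M f a b ∧
  ∀ x ∈ M, ∀ x' ∈ M, ∀ y ∈ M, PairMemIn M f x y → PairMemIn M f x' y → x = x'

/-- `M ⊨ |a| < δ`, for an `M`-cardinal `δ`: in `M`, `a` injects into an element of `δ`. -/
def CardLTIn (M : Set ZFSet.{u}) (a δ : ZFSet.{u}) : Prop :=
  ∃ β ∈ M, β ∈ δ ∧ ∃ f ∈ M, IsInjectionIn M f a β

/-- `M ⊨ x` is a transitive set. -/
def IsTransitiveIn (M : Set ZFSet.{u}) (x : ZFSet.{u}) : Prop :=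
  ∀ y ∈ M, y ∈ x → ∀ z ∈ M, z ∈ y → z ∈ x

/-- `M ⊨ x` is an ordinal (a transitive set of transitive sets). -/
def IsOrdinalIn (M : Set ZFSet.{u}) (x : ZFSet.{u}) : Prop :=
  IsTransitiveIn M x ∧ ∀ y ∈ M, y ∈ x → IsTransitiveIn M y

/-- `M ⊨ δ` is an infinite regular cardinal: `δ` is a nonzero limit ordinal, `δ` does not inject
into a smaller ordinal, and no function from a smaller ordinal to `δ` is unbounded in `δ`. -/
def IsRegularCardinalIn (M : Set ZFSet.{u}) (δ : ZFSet.{u}) : Prop :=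
  IsOrdinalIn M δ ∧
  (∃ β ∈ M, β ∈ δ) ∧ (∀ β ∈ M, β ∈ δ → ∃ γ ∈ M, γ ∈ δ ∧ β ∈ γ) ∧
  ¬ CardLTIn M δ δ ∧
  ∀ β ∈ M, β ∈ δ → ∀ f ∈ M, IsFunctionIn M f β δ →
    ∃ γ ∈ M, γ ∈ δ ∧ ∀ x ∈ M, ∀ y ∈ M, PairMemIn M f x y → y ∈ γ

/-! ### Guessing elementary submodels -/

/-- `κ = κ_M`: the least ordinal that is an element but not a subset of `M`. -/
def IsKappa (M : Set ZFSet.{u}) (κ : ZFSet.{u}) : Prop :=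
  (κ ∈ M ∧ κ.IsOrdinal ∧ ¬ (κ : Set ZFSet.{u}) ⊆ M) ∧
  ∀ α ∈ M, α.IsOrdinal → ¬ (α : Set ZFSet.{u}) ⊆ M → κ ⊆ α

/-- `x` is guessed in `M`: there is `x' ∈ M` with `x' ∩ M = x ∩ M`. -/
def IsGuessedIn (M : Set ZFSet.{u}) (x : ZFSet.{u}) : Prop :=
  ∃ x' ∈ M, (x' : Set ZFSet.{u}) ∩ M = (x : Set ZFSet.{u}) ∩ M

/-- `x` is `δ`-approximated in `M`. -/
def IsApproximatedIn (M : Set ZFSet.{u}) (δ x : ZFSet.{u}) : Prop :=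
  ∀ a ∈ M, CardLTIn M a δ → x ∩ a ∈ M

/-- The `δ`-guessing property (in `V`). -/
def HasGuessingProperty (M : Set ZFSet.{u}) (δ : ZFSet.{u}) : Prop :=
  ∀ x : ZFSet.{u}, IsBoundedIn M x → IsApproximatedIn M δ x → IsGuessedIn M x

/-- `M` is a `δ`-guessing elementary submodel. -/
def IsGuessingElementarySubmodel (M : Set ZFSet.{u}) (δ : ZFSet.{u}) : Prop :=
  (∃ κ, IsKappa M κ ∧ δ ⊆ κ) ∧ δ ∈ M ∧ IsRegularCardinalIn M δ ∧
  (∃ H, IsPowerful H ∧ IsElementarySubmodel M H) ∧ HasGuessingProperty M δ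

/-! ### The guessing model principle -/

/-- `H_θ`: the sets whose transitive closure has cardinality less than `θ`. -/
def hereditary (θ : Cardinal.{u}) : Set ZFSet.{u} :=
  {x | ∃ t : ZFSet.{u}, t.IsTransitive ∧ x ⊆ t ∧ t.card < θ}

/-- `P_κ(X)`: the subsets of `X` of cardinality less than `κ`. -/
def smallSubsets (κ : Cardinal.{u}) (X : Set ZFSet.{u}) : Set (Set ZFSet.{u}) :=
  {A | A ⊆ X ∧ #A < Cardinal.lift.{u + 1} κ}

/-- `S` is stationary in `P_κ(X)`. -/
def IsStationary (κ : Cardinal.{u}) (X : Set ZFSet.{u}) (S : Set (Set ZFSet.{u})) : Prop :=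
  S ⊆ smallSubsets κ X ∧
  ∀ F : Set ZFSet.{u} → Set ZFSet.{u},
    (∀ a ∈ smallSubsets ℵ₀ X, F a ∈ smallSubsets κ X) →
    ∃ A ∈ S, ∀ a ∈ smallSubsets ℵ₀ A, F a ⊆ A

/-- The set of `δ`-guessing elementary submodels of `H` of cardinality less than `κ`. -/
def guessingModels (κ δ : Cardinal.{u}) (H : Set ZFSet.{u}) : Set (Set ZFSet.{u}) :=
  {M | M ∈ smallSubsets κ H ∧ IsElementarySubmodel M H ∧
    IsGuessingElementarySubmodel M δ.ord.toZFSet}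

/-- `GMP(κ, δ)`: for all sufficiently large regular `θ`, the `δ`-guessing elementary submodels of
`H_θ` form a stationary subset of `P_κ(H_θ)`. -/
def GMP (κ δ : Cardinal.{u}) : Prop :=
  ∃ θ₀ : Cardinal.{u}, ∀ θ : Cardinal.{u}, θ₀ ≤ θ → θ.IsRegular →
    IsStationary κ (hereditary θ) (guessingModels κ δ (hereditary θ))

/-! ### Trees: `T` is the set of nodes, `R` the set of pairs `(s, t)` with `s <_T t` -/

/-- The set `b_t = {s ∈ T : s <_T t}`, as a type. -/
abbrev Below (T R t : ZFSet.{u}) : Type (u + 1) := {s : ZFSet.{u} // s ∈ T ∧ ZFSet.pair s t ∈ R}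

/-- `(T, R)` is a tree: a strict partial order in which every `b_t` is well-ordered. -/
structure IsTree (T R : ZFSet.{u}) : Prop where
  subset_prod : R ⊆ ZFSet.prod T T
  irrefl : ∀ t ∈ T, ZFSet.pair t t ∉ R
  trans : ∀ r ∈ T, ∀ s ∈ T, ∀ t ∈ T, ZFSet.pair r s ∈ R → ZFSet.pair s t ∈ R → ZFSet.pair r t ∈ R
  wellOrder : ∀ t ∈ T, IsWellOrder (Below T R t) (fun a b => ZFSet.pair a.1 b.1 ∈ R)

/-- The node `t` has height `α`: `b_t` has order type `α`. -/
def HasHeight (T R t α : ZFSet.{u}) : Prop :=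
  α.IsOrdinal ∧
  Nonempty ((fun a b : Below T R t => ZFSet.pair a.1 b.1 ∈ R) ≃r
    (fun x y : {x : ZFSet.{u} // x ∈ α} => x.1 ∈ y.1))

/-- The level `T_α`. -/
noncomputable def level (T R α : ZFSet.{u}) : ZFSet.{u} := T.sep (fun t => HasHeight T R t α)

/-- `(T, R)` is a `κ`-tree (`κ` an infinite cardinal): a tree of height `κ` (its nonempty levels are
exactly the `T_α` with `α < κ`), all of whose levels have cardinality less than `κ`. -/
def IsKappaTree (κ T R : ZFSet.{u}) : Prop :=
  IsTree T R ∧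
  (∀ α : ZFSet.{u}, α.IsOrdinal → ((∃ t, t ∈ level T R α) ↔ α ∈ κ)) ∧
  ∀ α ∈ κ, (level T R α).card < κ.card

/-- `b` is a cofinal branch through the tree `(T, R)` of height `κ`: a downward closed chain that
meets every level `T_α`, `α < κ`. -/
def IsCofinalBranch (κ T R b : ZFSet.{u}) : Prop :=
  b ⊆ T ∧
  (∀ s ∈ b, ∀ t ∈ b, s = t ∨ ZFSet.pair s t ∈ R ∨ ZFSet.pair t s ∈ R) ∧
  (∀ t ∈ b, ∀ s ∈ T, ZFSet.pair s t ∈ R → s ∈ b) ∧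
  ∀ α ∈ κ, ∃ t ∈ b, t ∈ level T R α

/-- `(T, R)` is a `κ`-Aronszajn tree. -/
def IsAronszajnTree (κ T R : ZFSet.{u}) : Prop :=
  IsKappaTree κ T R ∧ ¬ ∃ b, IsCofinalBranch κ T R b

/-- The tree property at the cardinal `κ`. -/
def TreeProperty (κ : Cardinal.{u}) : Prop :=
  ¬ ∃ T R : ZFSet.{u}, IsAronszajnTree κ.ord.toZFSet T R

end GuessingModels

namespace GuessingModels

open Cardinal FirstOrder

/-! ### First-order definability, uniformly in all structures `(N, ∈)` -/

/-! Let `κ = κ_M` and let `(T, R) ∈ M` be a `κ`-tree. Pick `η ∈ κ` outside `M` and a node `t` of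
height `η`. The branch is read off from `b_t`, the set of predecessors of `t`. By minimality of `κ`,
each ordinal `α ∈ M ∩ κ` is a subset of `M`, so `α < η`. The level `T_α` is then an element of `M`
of size less than `κ`, hence a subset of `M`, and the predecessor of `t` of height `α` lies in `M`.

The set `b_t` is `κ`-approximated: if `a ∈ M` has size less than `κ`, regularity bounds the heights
of the nodes in `a` by some `γ ∈ M ∩ κ`. With `r ∈ M` the predecessor of `t` of height `γ`, `b_t ∩ a
= {s ∈ a : s <_T r}`, which is definable from parameters in `M`. So some `b ∈ M` agrees with `b_t`
on `M`. In `M` this `b` is a cofinal branch, and by elementarity and absoluteness of the powerful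
model it really is one. The core is `IsKappa.not_isAronszajnTree`.

For (2) and (3), stationarity yields small models containing the tree, and cardinality identifies
`κ_M` as `δ` or `δ⁺`. In (3), `δ`-guessing implies `δ⁺`-guessing, as approximation at `δ⁺` is the
stronger demand.

Elementarity is used through the class below: one formula must define `P` in `M` and in `H` alike,
and instance search builds it. -/

/-- `P` is defined by one formula of set theory in all structures `(N, ∈)`. -/
class FirstOrderDefinable {α : Type} (P : Set ZFSet.{u} → (α → ZFSet.{u}) → Prop) : Prop where
  out : ∃ φ : setLanguage.Formula α, ∀ (N : Set ZFSet.{u}) (v : α → N),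
    φ.Realize v ↔ P N (fun a => v a)

namespace FirstOrderDefinable

variable {α : Type} {P Q : Set ZFSet.{u} → (α → ZFSet.{u}) → Prop}

instance mem (i j : α) : FirstOrderDefinable (fun _ (v : α → ZFSet.{u}) => v i ∈ v j) where
  out := by
    let r : setLanguage.Relations 2 := MemRel.mem
    refine ⟨r.formula₂ (Language.Term.var i) (Language.Term.var j), fun N v => ?_⟩
    rw [Language.Formula.realize_rel₂]
    rfl

instance eq (i j : α) : FirstOrderDefinable (fun _ (v : α → ZFSet.{u}) => v i = v j) where
  out := ⟨(Language.Term.var i).equal (Language.Term.var j), fun N v => by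
    simp [Language.Formula.realize_equal, Subtype.ext_iff]⟩

instance not [hP : FirstOrderDefinable P] : FirstOrderDefinable (fun N v => ¬ P N v) where
  out := by
    obtain ⟨φ, hφ⟩ := hP.out
    exact ⟨φ.not, fun N v => by rw [Language.Formula.realize_not, hφ]⟩

instance and [hP : FirstOrderDefinable P] [hQ : FirstOrderDefinable Q] :
    FirstOrderDefinable (fun N v => P N v ∧ Q N v) where
  out := by
    obtain ⟨φ, hφ⟩ := hP.out
    obtain ⟨ψ, hψ⟩ := hQ.out
    exact ⟨φ ⊓ ψ, fun N v => by rw [Language.Formula.realize_inf, hφ, hψ]⟩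

instance or [hP : FirstOrderDefinable P] [hQ : FirstOrderDefinable Q] :
    FirstOrderDefinable (fun N v => P N v ∨ Q N v) where
  out := by
    obtain ⟨φ, hφ⟩ := hP.out
    obtain ⟨ψ, hψ⟩ := hQ.out
    exact ⟨φ ⊔ ψ, fun N v => by rw [Language.Formula.realize_sup, hφ, hψ]⟩

instance imp [hP : FirstOrderDefinable P] [hQ : FirstOrderDefinable Q] :
    FirstOrderDefinable (fun N v => P N v → Q N v) where
  out := by
    obtain ⟨φ, hφ⟩ := hP.out
    obtain ⟨ψ, hψ⟩ := hQ.out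
    exact ⟨φ.imp ψ, fun N v => by rw [Language.Formula.realize_imp, hφ, hψ]⟩

instance iff [hP : FirstOrderDefinable P] [hQ : FirstOrderDefinable Q] :
    FirstOrderDefinable (fun N v => P N v ↔ Q N v) where
  out := by
    obtain ⟨φ, hφ⟩ := hP.out
    obtain ⟨ψ, hψ⟩ := hQ.out
    exact ⟨φ.iff ψ, fun N v => by rw [Language.Formula.realize_iff, hφ, hψ]⟩

variable {S : Set ZFSet.{u} → (α → ZFSet.{u}) → ZFSet.{u} → Prop}

/-- The index `none` of `Option α` is the bound variable. Nested quantifiers iterate `Option`, so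
unfolding a relativized notion leaves only instance search. -/
instance ex [hS : FirstOrderDefinable
    (fun N (w : Option α → ZFSet.{u}) => S N (fun a => w (some a)) (w none))] :
    FirstOrderDefinable (fun N v => ∃ x ∈ N, S N v x) where
  out := by
    obtain ⟨φ, hφ⟩ := hS.out
    refine ⟨(φ.relabel (fun o => o.elim (Sum.inr ()) Sum.inl : Option α → α ⊕ Unit)).iExs Unit,
      fun N v => ?_⟩
    simp only [Language.Formula.realize_iExs, Language.Formula.realize_relabel, hφ]
    constructor
    · rintro ⟨i, hi⟩
      exact ⟨i (), (i ()).2, hi⟩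
    · rintro ⟨x, hx, h⟩
      exact ⟨fun _ => ⟨x, hx⟩, h⟩

instance all [hS : FirstOrderDefinable
    (fun N (w : Option α → ZFSet.{u}) => S N (fun a => w (some a)) (w none))] :
    FirstOrderDefinable (fun N v => ∀ x ∈ N, S N v x) where
  out := by
    have : FirstOrderDefinable (fun N v => ¬ ∃ x ∈ N, ¬ S N v x) :=
      not (hP := ex (S := fun N v x => ¬ S N v x) (hS := not (hP := hS)))
    obtain ⟨φ, hφ⟩ := this.out
    refine ⟨φ, fun N v => (hφ N v).trans ?_⟩
    push Not
    rfl

instance isPairIn (i j k : α) :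
    FirstOrderDefinable (fun N (v : α → ZFSet.{u}) => IsPairIn N (v i) (v j) (v k)) := by
  unfold IsPairIn; infer_instance

instance pairMemIn (i j k : α) :
    FirstOrderDefinable (fun N (v : α → ZFSet.{u}) => PairMemIn N (v i) (v j) (v k)) := by
  unfold PairMemIn; infer_instance

instance isFunctionIn (i j k : α) :
    FirstOrderDefinable (fun N (v : α → ZFSet.{u}) => IsFunctionIn N (v i) (v j) (v k)) := by
  unfold IsFunctionIn; infer_instance

instance isInjectionIn (i j k : α) :
    FirstOrderDefinable (fun N (v : α → ZFSet.{u}) => IsInjectionIn N (v i) (v j) (v k)) := by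
  unfold IsInjectionIn; infer_instance

instance cardLTIn (i j : α) :
    FirstOrderDefinable (fun N (v : α → ZFSet.{u}) => CardLTIn N (v i) (v j)) := by
  unfold CardLTIn; infer_instance

instance isRegularCardinalIn (i : α) :
    FirstOrderDefinable (fun N (v : α → ZFSet.{u}) => IsRegularCardinalIn N (v i)) := by
  unfold IsRegularCardinalIn IsOrdinalIn IsTransitiveIn; infer_instance

end FirstOrderDefinable

theorem IsElementarySubmodel.iff_of_definable {M H : Set ZFSet.{u}} (h : IsElementarySubmodel M H)
    {α : Type} (P : Set ZFSet.{u} → (α → ZFSet.{u}) → Prop) [hP : FirstOrderDefinable P]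
    (v : α → ZFSet.{u}) (hv : ∀ a, v a ∈ M) : P M v ↔ P H v := by
  obtain ⟨φ, hφ⟩ := hP.out
  obtain ⟨hMH, h⟩ := h
  let e : M ↪ₑ[setLanguage] H := ⟨Set.inclusion hMH, fun n φ v => h n φ v⟩
  have := e.map_formula φ (fun a => ⟨v a, hv a⟩)
  rw [hφ, hφ] at this
  exact this.symm

theorem IsElementarySubmodel.iff₁ {M H : Set ZFSet.{u}} (h : IsElementarySubmodel M H)
    (P : Set ZFSet.{u} → ZFSet.{u} → Prop)
    [FirstOrderDefinable fun N (v : Fin 1 → ZFSet.{u}) => P N (v 0)]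
    {a : ZFSet.{u}} (ha : a ∈ M) :
    P M a ↔ P H a :=
  h.iff_of_definable (fun N (v : Fin 1 → ZFSet.{u}) => P N (v 0))
    ![a] (by simp [*])

theorem IsElementarySubmodel.iff₂ {M H : Set ZFSet.{u}} (h : IsElementarySubmodel M H)
    (P : Set ZFSet.{u} → ZFSet.{u} → ZFSet.{u} → Prop)
    [FirstOrderDefinable fun N (v : Fin 2 → ZFSet.{u}) => P N (v 0) (v 1)]
    {a b : ZFSet.{u}} (ha : a ∈ M) (hb : b ∈ M) :
    P M a b ↔ P H a b :=
  h.iff_of_definable (fun N (v : Fin 2 → ZFSet.{u}) => P N (v 0) (v 1))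
    ![a, b] (by simp [Fin.forall_fin_succ, *])

theorem IsElementarySubmodel.iff₃ {M H : Set ZFSet.{u}} (h : IsElementarySubmodel M H)
    (P : Set ZFSet.{u} → ZFSet.{u} → ZFSet.{u} → ZFSet.{u} → Prop)
    [FirstOrderDefinable fun N (v : Fin 3 → ZFSet.{u}) => P N (v 0) (v 1) (v 2)]
    {a b c : ZFSet.{u}} (ha : a ∈ M) (hb : b ∈ M) (hc : c ∈ M) :
    P M a b c ↔ P H a b c :=
  h.iff_of_definable (fun N (v : Fin 3 → ZFSet.{u}) => P N (v 0) (v 1) (v 2))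
    ![a, b, c] (by simp [Fin.forall_fin_succ, *])

theorem IsElementarySubmodel.iff₅ {M H : Set ZFSet.{u}} (h : IsElementarySubmodel M H)
    (P : Set ZFSet.{u} → ZFSet.{u} → ZFSet.{u} → ZFSet.{u} → ZFSet.{u} → ZFSet.{u} → Prop)
    [FirstOrderDefinable fun N (v : Fin 5 → ZFSet.{u}) => P N (v 0) (v 1) (v 2) (v 3) (v 4)]
    {a b c d e : ZFSet.{u}} (ha : a ∈ M) (hb : b ∈ M) (hc : c ∈ M) (hd : d ∈ M) (he : e ∈ M) :
    P M a b c d e ↔ P H a b c d e :=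
  h.iff_of_definable (fun N (v : Fin 5 → ZFSet.{u}) => P N (v 0) (v 1) (v 2) (v 3) (v 4))
    ![a, b, c, d, e] (by simp [Fin.forall_fin_succ, *])

/-- The Tarski–Vaught property: a definable relation satisfied in `H` is satisfied in `M`. -/
theorem IsElementarySubmodel.exists_mem_of_definable {M H : Set ZFSet.{u}}
    (h : IsElementarySubmodel M H) {α : Type}
    (P : Set ZFSet.{u} → (α → ZFSet.{u}) → ZFSet.{u} → Prop)
    [FirstOrderDefinable fun N (v : Option α → ZFSet.{u}) =>
      P N (fun a => v (some a)) (v none)]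
    (v : α → ZFSet.{u}) (hv : ∀ a, v a ∈ M) (hx : ∃ x ∈ H, P H v x) : ∃ x ∈ M, P H v x := by
  obtain ⟨x, hx, hP⟩ := (h.iff_of_definable (fun N v => ∃ x ∈ N, P N v x) v hv).2 hx
  refine ⟨x, hx, (h.iff_of_definable (fun N (v : Option α → ZFSet.{u}) =>
    P N (fun a => v (some a)) (v none)) (fun o => o.elim x v) ?_).1 hP⟩
  rintro (_ | a)
  exacts [hx, hv a]

theorem IsElementarySubmodel.exists_mem₂ {M H : Set ZFSet.{u}}
    (h : IsElementarySubmodel M H)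
    (P : Set ZFSet.{u} → ZFSet.{u} → ZFSet.{u} → ZFSet.{u} → Prop)
    [FirstOrderDefinable fun N (v : Option (Fin 2) → ZFSet.{u}) =>
      P N (v none) (v (some 0)) (v (some 1))]
    {a b : ZFSet.{u}} (ha : a ∈ M) (hb : b ∈ M)
    (hx : ∃ x ∈ H, P H x a b) : ∃ x ∈ M, P H x a b :=
  h.exists_mem_of_definable (fun N (v : Fin 2 → ZFSet.{u}) x => P N x (v 0) (v 1))
    ![a, b] (by simp [Fin.forall_fin_succ, *]) hx

theorem IsElementarySubmodel.exists_mem₃ {M H : Set ZFSet.{u}}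
    (h : IsElementarySubmodel M H)
    (P : Set ZFSet.{u} → ZFSet.{u} → ZFSet.{u} → ZFSet.{u} → ZFSet.{u} → Prop)
    [FirstOrderDefinable fun N (v : Option (Fin 3) → ZFSet.{u}) =>
      P N (v none) (v (some 0)) (v (some 1)) (v (some 2))]
    {a b c : ZFSet.{u}} (ha : a ∈ M) (hb : b ∈ M) (hc : c ∈ M)
    (hx : ∃ x ∈ H, P H x a b c) : ∃ x ∈ M, P H x a b c :=
  h.exists_mem_of_definable (fun N (v : Fin 3 → ZFSet.{u}) x => P N x (v 0) (v 1) (v 2))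
    ![a, b, c] (by simp [Fin.forall_fin_succ, *]) hx


/-! ### Pairs and functions in powerful models -/

variable {M H : Set ZFSet.{u}}

theorem IsPowerful.subset_mem (hH : IsPowerful H) {x y : ZFSet.{u}} (hy : y ∈ H) (h : x ⊆ y) :
    x ∈ H := hH.bounded_mem x ⟨y, hy, h⟩

/-- By transitivity `H` sees all elements of `p`, and pairing puts `{x}` and `{x, y}` in `H`. -/
theorem IsPowerful.isPairIn_iff (hH : IsPowerful H) {p x y : ZFSet.{u}} (hp : p ∈ H) (hx : x ∈ H)
    (hy : y ∈ H) : IsPairIn H p x y ↔ p = ZFSet.pair x y := by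
  have h₁ : ∀ z ∈ H, (∀ w ∈ H, w ∈ z ↔ w = x) ↔ z = {x} := fun z hz => by
    rw [ZFSet.ext_iff]
    simp only [ZFSet.mem_singleton]
    exact ⟨fun h w => ⟨fun hw => (h w (hH.transitive z hz w hw)).1 hw,
      fun hw => (h w (hw ▸ hx)).2 hw⟩, fun h w _ => h w⟩
  have h₂ : ∀ z ∈ H, (∀ w ∈ H, w ∈ z ↔ (w = x ∨ w = y)) ↔ z = {x, y} := fun z hz => by
    rw [ZFSet.ext_iff]
    simp only [ZFSet.mem_pair]
    refine ⟨fun h w => ⟨fun hw => (h w (hH.transitive z hz w hw)).1 hw, fun hw => ?_⟩,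
      fun h w _ => h w⟩
    exact (h w (hw.elim (fun e => e ▸ hx) (fun e => e ▸ hy))).2 hw
  have hxx : ({x} : ZFSet.{u}) ∈ H := ZFSet.pair_eq_singleton x ▸ hH.pairing x hx x hx
  have hxy := hH.pairing x hx y hy
  rw [ZFSet.ext_iff, ZFSet.pair]
  simp only [ZFSet.mem_pair]
  constructor
  · intro h z
    constructor
    · intro hz
      have hzH := hH.transitive p hp z hz
      simpa only [h₁ z hzH, h₂ z hzH] using (h z hzH).1 hz
    · rintro (rfl | rfl)
      · exact (h _ hxx).2 (Or.inl ((h₁ _ hxx).2 rfl))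
      · exact (h _ hxy).2 (Or.inr ((h₂ _ hxy).2 rfl))
  · intro h z hz
    rw [h₁ z hz, h₂ z hz, h]

theorem IsPowerful.of_pair_mem (hH : IsPowerful H) {x y : ZFSet.{u}} (h : ZFSet.pair x y ∈ H) :
    x ∈ H ∧ y ∈ H := by
  have h' : ({x, y} : ZFSet.{u}) ∈ H := hH.transitive _ h _ (by simp [ZFSet.pair])
  exact ⟨hH.transitive _ h' _ (by simp), hH.transitive _ h' _ (by simp)⟩

theorem IsPowerful.pairMemIn_iff (hH : IsPowerful H) {f x y : ZFSet.{u}} (hf : f ∈ H) (hx : x ∈ H)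
    (hy : y ∈ H) : PairMemIn H f x y ↔ ZFSet.pair x y ∈ f := by
  constructor
  · rintro ⟨p, hp, hpf, h⟩
    exact (hH.isPairIn_iff hp hx hy).1 h ▸ hpf
  · intro h
    have hp := hH.transitive f hf _ h
    exact ⟨_, hp, h, (hH.isPairIn_iff hp hx hy).2 rfl⟩

theorem IsPowerful.isFunctionIn_iff (hH : IsPowerful H) {f a b : ZFSet.{u}} (hf : f ∈ H)
    (ha : a ∈ H) (hb : b ∈ H) : IsFunctionIn H f a b ↔ ZFSet.IsFunc a b f := by
  constructor
  · rintro ⟨h₁, h₂⟩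
    refine ⟨fun p hp => ?_, fun x hx => ?_⟩
    · have hpH := hH.transitive f hf p hp
      obtain ⟨x, hxH, hx, y, hyH, hy, h⟩ := h₁ p hpH hp
      exact ZFSet.mem_prod.2 ⟨x, hx, y, hy, (hH.isPairIn_iff hpH hxH hyH).1 h⟩
    · have hxH := hH.transitive a ha x hx
      obtain ⟨y, hyH, hy, huniq⟩ := h₂ x hxH hx
      refine ⟨y, (hH.pairMemIn_iff hf hxH hyH).1 hy, fun y' hy' => ?_⟩
      have hyH' := (hH.of_pair_mem (hH.transitive f hf _ hy')).2
      exact huniq y' hyH' ((hH.pairMemIn_iff hf hxH hyH').2 hy')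
  · rintro ⟨h₁, h₂⟩
    refine ⟨fun p hpH hp => ?_, fun x hxH hx => ?_⟩
    · obtain ⟨x, hx, y, hy, rfl⟩ := ZFSet.mem_prod.1 (h₁ hp)
      have hxH := hH.transitive a ha x hx
      have hyH := hH.transitive b hb y hy
      exact ⟨x, hxH, hx, y, hyH, hy, (hH.isPairIn_iff hpH hxH hyH).2 rfl⟩
    · obtain ⟨y, hy, huniq⟩ := h₂ x hx
      have hyH := (hH.of_pair_mem (hH.transitive f hf _ hy)).2
      exact ⟨y, hyH, (hH.pairMemIn_iff hf hxH hyH).2 hy,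
        fun y' hyH' hy' => huniq y' ((hH.pairMemIn_iff hf hxH hyH').1 hy')⟩

theorem IsPowerful.isInjectionIn_iff (hH : IsPowerful H) {f a b : ZFSet.{u}} (hf : f ∈ H)
    (ha : a ∈ H) (hb : b ∈ H) : IsInjectionIn H f a b ↔ ZFSet.IsFunc a b f ∧
      ∀ x x' y, ZFSet.pair x y ∈ f → ZFSet.pair x' y ∈ f → x = x' := by
  rw [IsInjectionIn, hH.isFunctionIn_iff hf ha hb]
  refine and_congr_right fun _ => ⟨fun h x x' y hx hx' => ?_, fun h x hx x' hx' y hy h₁ h₂ => ?_⟩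
  · have h₁ := hH.of_pair_mem (hH.transitive f hf _ hx)
    have h₂ := hH.of_pair_mem (hH.transitive f hf _ hx')
    exact h x h₁.1 x' h₂.1 y h₁.2 ((hH.pairMemIn_iff hf h₁.1 h₁.2).2 hx)
      ((hH.pairMemIn_iff hf h₂.1 h₁.2).2 hx')
  · exact h x x' y ((hH.pairMemIn_iff hf hx hy).1 h₁) ((hH.pairMemIn_iff hf hx' hy).1 h₂)

/-- The graph of `g` on `a`, for `g` with values in `b` on `a`. -/
noncomputable def graphOn (g : ZFSet.{u} → ZFSet.{u}) (a b : ZFSet.{u}) : ZFSet.{u} :=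
  ZFSet.pairSep (fun x y => y = g x) a b

theorem pair_mem_graphOn {g : ZFSet.{u} → ZFSet.{u}} {a b x y : ZFSet.{u}} :
    ZFSet.pair x y ∈ graphOn g a b ↔ x ∈ a ∧ y ∈ b ∧ y = g x := by
  simp only [graphOn, ZFSet.mem_pairSep, ZFSet.pair_inj]
  constructor
  · rintro ⟨x', hx, y', hy, ⟨rfl, rfl⟩, h⟩
    exact ⟨hx, hy, h⟩
  · rintro ⟨hx, hy, h⟩
    exact ⟨x, hx, y, hy, ⟨rfl, rfl⟩, h⟩

theorem isFunc_graphOn {g : ZFSet.{u} → ZFSet.{u}} {a b : ZFSet.{u}} (h : ∀ x ∈ a, g x ∈ b) :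
    ZFSet.IsFunc a b (graphOn g a b) := by
  refine ⟨fun p hp => ?_, fun x hx => ⟨g x, pair_mem_graphOn.2 ⟨hx, h x hx, rfl⟩, fun y hy =>
    (pair_mem_graphOn.1 hy).2.2⟩⟩
  obtain ⟨x, hx, y, hy, rfl, -⟩ := ZFSet.mem_pairSep.1 hp
  exact ZFSet.pair_mem_prod.2 ⟨hx, hy⟩

/-- A function is a subset of a product in `H`. So `H` has all functions of `V` between its
elements, which makes its smallness and regularity statements genuine. -/
theorem IsPowerful.func_mem (hH : IsPowerful H) {f a b : ZFSet.{u}} (ha : a ∈ H) (hb : b ∈ H)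
    (hf : ZFSet.IsFunc a b f) : f ∈ H :=
  hH.subset_mem (hH.product a ha b hb) hf.1

theorem IsPowerful.exists_isInjectionIn (hH : IsPowerful H) {a b : ZFSet.{u}} (ha : a ∈ H)
    (hb : b ∈ H) {g : ZFSet.{u} → ZFSet.{u}} (hg : ∀ x ∈ a, g x ∈ b)
    (hinj : ∀ x ∈ a, ∀ y ∈ a, g x = g y → x = y) : ∃ f ∈ H, IsInjectionIn H f a b := by
  have hf := isFunc_graphOn hg
  have hfH := hH.func_mem ha hb hf
  refine ⟨_, hfH, (hH.isInjectionIn_iff hfH ha hb).2 ⟨hf, fun x x' y h h' => ?_⟩⟩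
  rw [pair_mem_graphOn] at h h'
  exact hinj x h.1 x' h'.1 (h.2.2.symm.trans h'.2.2)

/-- A set whose cardinality is at most that of `b` injects into `b`. -/
theorem exists_injOn_of_card_le {a b : ZFSet.{u}} (h : a.card ≤ b.card) :
    ∃ g : ZFSet.{u} → ZFSet.{u}, (∀ x ∈ a, g x ∈ b) ∧ ∀ x ∈ a, ∀ y ∈ a, g x = g y → x = y := by
  classical
  have h' : #a ≤ #b := by
    rw [ZFSet.cardinalMk_coe_sort, ZFSet.cardinalMk_coe_sort]
    exact Cardinal.lift_le.2 h
  obtain ⟨e⟩ := h'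
  refine ⟨fun x => if hx : x ∈ a then (e ⟨x, hx⟩ : ZFSet.{u}) else ∅, fun x hx => ?_,
    fun x hx y hy hxy => ?_⟩
  · simp only [hx, dite_true]
    exact (e ⟨x, hx⟩).2
  · simp only [hx, hy, dite_true] at hxy
    exact congrArg Subtype.val (e.injective (Subtype.ext hxy))

theorem card_le_of_injOn {a b : ZFSet.{u}} (g : ZFSet.{u} → ZFSet.{u}) (hg : ∀ x ∈ a, g x ∈ b)
    (hinj : ∀ x ∈ a, ∀ y ∈ a, g x = g y → x = y) : a.card ≤ b.card := by
  rw [← Cardinal.lift_le.{u + 1}, ← ZFSet.cardinalMk_coe_sort, ← ZFSet.cardinalMk_coe_sort]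
  exact Cardinal.mk_le_of_injective (f := fun x : a => (⟨g x, hg x x.2⟩ : b)) fun x y hxy =>
    Subtype.ext (hinj x x.2 y y.2 (congrArg Subtype.val hxy))

/-! ### Elementary submodels of powerful models -/

theorem IsElementarySubmodel.subset (hM : IsElementarySubmodel M H) : M ⊆ H := hM.1

theorem IsElementarySubmodel.pairMemIn_iff (hM : IsElementarySubmodel M H) (hH : IsPowerful H)
    {f x y : ZFSet.{u}} (hf : f ∈ M) (hx : x ∈ M) (hy : y ∈ M) :
    PairMemIn M f x y ↔ ZFSet.pair x y ∈ f := by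
  rw [← hH.pairMemIn_iff (hM.subset hf) (hM.subset hx) (hM.subset hy)]
  exact hM.iff₃ PairMemIn hf hx hy

/-- `M` need not be transitive, but the coordinates of a pair are definable from it. -/
theorem IsElementarySubmodel.of_pair_mem (hM : IsElementarySubmodel M H) (hH : IsPowerful H)
    {x y : ZFSet.{u}} (h : ZFSet.pair x y ∈ M) : x ∈ M ∧ y ∈ M := by
  have hp := hM.subset h
  obtain ⟨hx, hy⟩ := hH.of_pair_mem hp
  have h₁ : ∃ x' ∈ M, ∃ y' ∈ M, IsPairIn M (ZFSet.pair x y) x' y' :=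
    (hM.iff₁ (fun N u => ∃ x' ∈ N, ∃ y' ∈ N, IsPairIn N u x' y') h).2
      ⟨x, hx, y, hy, (hH.isPairIn_iff hp hx hy).2 rfl⟩
  obtain ⟨x', hx', y', hy', h₂⟩ := h₁
  have h₃ : IsPairIn H (ZFSet.pair x y) x' y' :=
    (hM.iff₃ IsPairIn h hx' hy').1 h₂
  obtain ⟨rfl, rfl⟩ := ZFSet.pair_inj.1
    ((hH.isPairIn_iff hp (hM.subset hx') (hM.subset hy')).1 h₃)
  exact ⟨hx', hy'⟩

/-- If `f ∈ M` is a function injective on `a ∈ M`, and its values are in `M`, then `a ⊆ M`. -/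
theorem IsElementarySubmodel.subset_of_injection (hM : IsElementarySubmodel M H)
    (hH : IsPowerful H) {a b : ZFSet.{u}} (ha : a ∈ M) (hb : b ∈ M)
    (hbM : ∀ y ∈ b, y ∈ M) (h : ∃ f ∈ H, IsInjectionIn H f a b) : ∀ x ∈ a, x ∈ M := by
  have h₁ : ∃ f ∈ M, IsInjectionIn M f a b :=
    (hM.iff₂ (fun N u v => ∃ f ∈ N, IsInjectionIn N f u v) ha hb).2 h
  obtain ⟨f, hf, hinj⟩ := h₁
  have hinjH : IsInjectionIn H f a b :=
    (hM.iff₃ IsInjectionIn hf ha hb).1 hinj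
  obtain ⟨hfun, hinj'⟩ :=
    (hH.isInjectionIn_iff (hM.subset hf) (hM.subset ha) (hM.subset hb)).1 hinjH
  intro x hx
  obtain ⟨y, hy, -⟩ := hfun.2 x hx
  have hyM : y ∈ M := hbM y (ZFSet.pair_mem_prod.1 (hfun.1 hy)).2
  have hxH := hH.transitive a (hM.subset ha) x hx
  -- Elementarity provides a preimage of `y` in `M`; by injectivity it is `x`.
  have h₂ : ∃ z ∈ M, PairMemIn M f z y :=
    (hM.iff₂ (fun N u v => ∃ z ∈ N, PairMemIn N u z v) hf hyM).2
      ⟨x, hxH, (hH.pairMemIn_iff (hM.subset hf) hxH (hM.subset hyM)).2 hy⟩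
  obtain ⟨z, hz, hzy⟩ := h₂
  rw [hM.pairMemIn_iff hH hf hz hyM] at hzy
  exact hinj' z x y hzy hy ▸ hz

theorem IsElementarySubmodel.isRegularCardinalIn_iff (hM : IsElementarySubmodel M H)
    {κ : ZFSet.{u}} (hκ : κ ∈ M) : IsRegularCardinalIn M κ ↔ IsRegularCardinalIn H κ :=
  hM.iff₁ IsRegularCardinalIn hκ

theorem IsElementarySubmodel.cardLTIn_iff (hM : IsElementarySubmodel M H)
    {a κ : ZFSet.{u}} (ha : a ∈ M) (hκ : κ ∈ M) : CardLTIn M a κ ↔ CardLTIn H a κ :=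
  hM.iff₂ CardLTIn ha hκ

/-- Otherwise minimality gives `κ ⊆ α`, hence `α ∈ α`. -/
theorem IsKappa.subset_of_mem {κ : ZFSet.{u}} (hκ : IsKappa M κ) {α : ZFSet.{u}} (hα : α ∈ M)
    (h : α ∈ κ) : ∀ x ∈ α, x ∈ M := by
  by_contra hn
  exact ZFSet.mem_irrefl α (hκ.2 α hα (hκ.1.2.1.mem h) (fun h' => hn fun x hx => h' hx) h)

/-- Elements of `M` of size less than `κ_M` are subsets of `M`. -/
theorem IsKappa.subset_of_cardLTIn {κ : ZFSet.{u}} (hκ : IsKappa M κ)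
    (hM : IsElementarySubmodel M H) (hH : IsPowerful H) {a : ZFSet.{u}} (ha : a ∈ M)
    (h : CardLTIn H a κ) : ∀ x ∈ a, x ∈ M := by
  obtain ⟨β, hβM, hβ, f, hf, hinj⟩ := (hM.cardLTIn_iff ha hκ.1.1).2 h
  refine hM.subset_of_injection hH ha hβM (hκ.subset_of_mem hβM hβ) ⟨f, hM.subset hf, ?_⟩
  exact (hM.iff₃ IsInjectionIn hf ha hβM).1 hinj

/-- Functions on a set of size less than a regular cardinal are bounded. -/
theorem IsRegularCardinalIn.exists_bound {κ a : ZFSet.{u}} (hκ : IsRegularCardinalIn H κ)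
    (hH : IsPowerful H) (hκH : κ ∈ H) (ha : CardLTIn H a κ) (haH : a ∈ H)
    (g : ZFSet.{u} → ZFSet.{u}) {s : Set ZFSet.{u}} (hg : ∀ x ∈ a, x ∈ s → g x ∈ κ) :
    ∃ γ ∈ κ, ∀ x ∈ a, x ∈ s → g x ∈ γ := by
  classical
  obtain ⟨-, ⟨ζ, -, hζ⟩, -, -, hreg⟩ := hκ
  obtain ⟨β, hβH, hβ, f, hf, hinj⟩ := ha
  obtain ⟨hfun, hinj'⟩ := (hH.isInjectionIn_iff hf haH hβH).1 hinj
  -- Regularity speaks of functions on elements of `κ`, so `g` is carried along the injection `f` to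
  -- `β`; `ζ` is a harmless default elsewhere.
  let G : ZFSet.{u} → ZFSet.{u} := fun ξ =>
    if h : ∃ x ∈ a, x ∈ s ∧ ZFSet.pair x ξ ∈ f then g h.choose else ζ
  have hG : ∀ ξ ∈ β, G ξ ∈ κ := fun ξ _ => by
    by_cases h : ∃ x ∈ a, x ∈ s ∧ ZFSet.pair x ξ ∈ f
    · simp only [G, h, dite_true]
      exact hg _ h.choose_spec.1 h.choose_spec.2.1
    · simp only [G, h, dite_false]
      exact hζ
  have hgr := isFunc_graphOn hG
  have hgrH := hH.func_mem hβH hκH hgr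
  obtain ⟨γ, -, hγ, hb⟩ := hreg β hβH hβ _ hgrH ((hH.isFunctionIn_iff hgrH hβH hκH).2 hgr)
  refine ⟨γ, hγ, fun x hx hxs => ?_⟩
  obtain ⟨ξ, hξ, -⟩ := hfun.2 x hx
  have hξβ := (ZFSet.pair_mem_prod.1 (hfun.1 hξ)).2
  have h : ∃ x ∈ a, x ∈ s ∧ ZFSet.pair x ξ ∈ f := ⟨x, hx, hxs, hξ⟩
  have hGx : G ξ = g x := by
    simp only [G, h, dite_true]
    rw [hinj' _ _ _ h.choose_spec.2.2 hξ]
  have hξH := hH.transitive β hβH ξ hξβ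
  have hgH := hH.transitive κ hκH _ (hG ξ hξβ)
  rw [← hGx]
  exact hb ξ hξH _ hgH ((hH.pairMemIn_iff hgrH hξH hgH).2
    (pair_mem_graphOn.2 ⟨hξβ, hG ξ hξβ, rfl⟩))


/-! ### Heights of nodes -/

variable {T R : ZFSet.{u}}

/-- Transitive sets are rigid: by `∈`-induction `e x` and `x` have the same elements. Hence heights
are unique. -/
theorem coe_relIso_eq {α β : ZFSet.{u}} (hα : α.IsTransitive) (hβ : β.IsTransitive)
    (e : (fun x y : {x : ZFSet.{u} // x ∈ α} => x.1 ∈ y.1) ≃r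
      (fun x y : {x : ZFSet.{u} // x ∈ β} => x.1 ∈ y.1)) (x : ZFSet.{u}) :
    ∀ hx : x ∈ α, (e ⟨x, hx⟩ : ZFSet.{u}) = x := by
  induction x using ZFSet.inductionOn with
  | _ x ih =>
    intro hx
    ext z
    constructor
    · intro hz
      have hzβ : z ∈ β := hβ.mem_trans hz (e ⟨x, hx⟩).2
      have h := (e.symm.map_rel_iff (a := ⟨z, hzβ⟩) (b := e ⟨x, hx⟩)).2 hz
      rw [e.symm_apply_apply] at h
      have h' := ih _ h (e.symm ⟨z, hzβ⟩).2
      simp only [Subtype.coe_eta, RelIso.apply_symm_apply] at h'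
      rw [h']
      exact h
    · intro hz
      have hzα := hα.mem_trans hz hx
      have h := (e.map_rel_iff (a := ⟨z, hzα⟩) (b := ⟨x, hx⟩)).2 hz
      rwa [ih z hz hzα] at h

theorem HasHeight.unique {t α β : ZFSet.{u}} (hα : HasHeight T R t α) (hβ : HasHeight T R t β) :
    α = β := by
  obtain ⟨hαo, ⟨e⟩⟩ := hα
  obtain ⟨hβo, ⟨f⟩⟩ := hβ
  ext x
  constructor
  · intro hx
    rw [← coe_relIso_eq hαo.isTransitive hβo.isTransitive (e.symm.trans f) x hx]
    exact Subtype.prop _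
  · intro hx
    rw [← coe_relIso_eq hβo.isTransitive hαo.isTransitive (f.symm.trans e) x hx]
    exact Subtype.prop _

theorem nonempty_relIso_toZFSet (o : Ordinal.{u}) :
    Nonempty ((fun a b : Set.Iio o => a < b) ≃r
      (fun x y : {x : ZFSet.{u} // x ∈ o.toZFSet} => x.1 ∈ y.1)) := by
  refine ⟨⟨Equiv.ofBijective
    (fun a => ⟨a.1.toZFSet, Ordinal.toZFSet_mem_toZFSet_iff.2 a.2⟩) ⟨?_, ?_⟩, ?_⟩⟩
  · intro a b h
    exact Subtype.ext (Ordinal.toZFSet_injective (congrArg Subtype.val h))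
  · rintro ⟨x, hx⟩
    obtain ⟨a, ha, rfl⟩ := Ordinal.mem_toZFSet_iff.1 hx
    exact ⟨⟨a, ha⟩, rfl⟩
  · intro a b
    exact Ordinal.toZFSet_mem_toZFSet_iff

theorem IsTree.exists_hasHeight (hT : IsTree T R) {t : ZFSet.{u}} (ht : t ∈ T) :
    ∃ α, HasHeight T R t α := by
  have hwo := hT.wellOrder t ht
  let r : Below T R t → Below T R t → Prop := fun a b => ZFSet.pair a.1 b.1 ∈ R
  -- The order type of `b_t` must be an ordinal of universe `u`, while `Below` lives one universe
  -- up.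
  have hsmall : Small.{u} (Below T R t) :=
    small_of_injective (β := {x : ZFSet.{u} // x ∈ T}) (f := fun s => ⟨s.1, s.2.1⟩) fun a b h =>
      Subtype.ext (Subtype.ext_iff.1 h :)
  let q := equivShrink.{u} (Below T R t)
  let e : (q.symm ⁻¹'o r) ≃r r := RelIso.preimage q.symm r
  have : IsWellOrder (Shrink.{u} (Below T R t)) (q.symm ⁻¹'o r) :=
    e.toRelEmbedding.isWellOrder
  obtain ⟨f⟩ := nonempty_relIso_toZFSet (Ordinal.type (q.symm ⁻¹'o r))
  exact ⟨_, ZFSet.isOrdinal_toZFSet _, ⟨(e.symm.trans (Ordinal.enum _).symm).trans f⟩⟩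

/-- The isomorphism from `b_t` to `α` restricts, for `s` below `t`, to one from `b_s` to the ordinal
`e s`. So the elements of `α` are exactly the heights of predecessors of `t`. -/
theorem HasHeight.mem_iff (hT : IsTree T R) {t α : ZFSet.{u}} (ht : t ∈ T)
    (hα : HasHeight T R t α) (ξ : ZFSet.{u}) :
    ξ ∈ α ↔ ∃ s ∈ T, ZFSet.pair s t ∈ R ∧ HasHeight T R s ξ := by
  obtain ⟨hαo, ⟨e⟩⟩ := hα
  have key : ∀ s : Below T R t, HasHeight T R s.1 (e s) := fun s => by
    refine ⟨hαo.mem (e s).2, ⟨⟨Equiv.ofBijective (fun r => ⟨e ⟨r.1, r.2.1,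
      hT.trans _ r.2.1 _ s.2.1 _ ht r.2.2 s.2.2⟩, e.map_rel_iff.2 r.2.2⟩) ⟨?_, ?_⟩, ?_⟩⟩⟩
    · intro a b h
      have h' := e.injective (Subtype.ext (Subtype.ext_iff.1 h :))
      exact Subtype.ext (Subtype.ext_iff.1 h' :)
    · rintro ⟨x, hx⟩
      have hxα := hαo.mem_trans hx (e s).2
      have h := (e.symm.map_rel_iff (a := ⟨x, hxα⟩) (b := e s)).2 hx
      rw [e.symm_apply_apply] at h
      refine ⟨⟨(e.symm ⟨x, hxα⟩).1, (e.symm ⟨x, hxα⟩).2.1, h⟩, Subtype.ext ?_⟩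
      exact (Subtype.ext_iff.1 (e.apply_symm_apply ⟨x, hxα⟩) :)
    · intro a b
      exact e.map_rel_iff
  constructor
  · intro hξ
    refine ⟨_, (e.symm ⟨ξ, hξ⟩).2.1, (e.symm ⟨ξ, hξ⟩).2.2, ?_⟩
    simpa using key (e.symm ⟨ξ, hξ⟩)
  · rintro ⟨s, hs, hst, hξ⟩
    rw [hξ.unique (key ⟨s, hs, hst⟩)]
    exact (e ⟨s, hs, hst⟩).2

/-- Of two nodes below a third one, the one of smaller height is below the other. -/
theorem IsTree.pair_mem_of_height_mem (hT : IsTree T R) {r s t α β : ZFSet.{u}} (hr : r ∈ T)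
    (hs : s ∈ T) (ht : t ∈ T) (hrt : ZFSet.pair r t ∈ R) (hst : ZFSet.pair s t ∈ R)
    (hα : HasHeight T R r α) (hβ : HasHeight T R s β) (h : α ∈ β) : ZFSet.pair r s ∈ R := by
  have := hT.wellOrder t ht
  rcases trichotomous_of (fun a b : Below T R t => ZFSet.pair a.1 b.1 ∈ R)
    ⟨r, hr, hrt⟩ ⟨s, hs, hst⟩ with h' | h' | h'
  · exact h'
  · obtain rfl : r = s := congrArg Subtype.val h'
    exact absurd (hα.unique hβ ▸ h) (ZFSet.mem_irrefl _)
  · exact absurd ((hα.mem_iff hT hr β).2 ⟨s, hs, h', hβ⟩) (ZFSet.mem_asymm h)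

/-- The recursive description of the height function. -/
theorem hasHeight_iff_of_recursion (hT : IsTree T R) {h : ZFSet.{u} → ZFSet.{u}}
    (hh : ∀ t ∈ T, ∀ ξ, ξ ∈ h t ↔ ∃ s ∈ T, ZFSet.pair s t ∈ R ∧ h s = ξ) {t : ZFSet.{u}}
    (ht : t ∈ T) (α : ZFSet.{u}) : HasHeight T R t α ↔ h t = α := by
  have key : ∀ α : ZFSet.{u}, ∀ t ∈ T, HasHeight T R t α → h t = α := by
    intro α
    induction α using ZFSet.inductionOn with
    | _ α ih =>
      intro t ht hα
      ext ξ
      rw [hh t ht, hα.mem_iff hT ht]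
      constructor
      · rintro ⟨s, hs, hst, rfl⟩
        obtain ⟨β, hβ⟩ := hT.exists_hasHeight hs
        exact ⟨s, hs, hst, ih β ((hα.mem_iff hT ht β).2 ⟨s, hs, hst, hβ⟩) s hs hβ ▸ hβ⟩
      · rintro ⟨s, hs, hst, hξ⟩
        exact ⟨s, hs, hst, ih ξ ((hα.mem_iff hT ht ξ).2 ⟨s, hs, hst, hξ⟩) s hs hξ⟩
  refine ⟨key α t ht, ?_⟩
  rintro rfl
  obtain ⟨β, hβ⟩ := hT.exists_hasHeight ht
  rwa [key β t ht hβ]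


/-! ### Trees in guessing models -/

variable {κ : ZFSet.{u}}

theorem IsKappaTree.height_mem (hT : IsKappaTree κ T R) {t α : ZFSet.{u}} (ht : t ∈ T)
    (hα : HasHeight T R t α) : α ∈ κ :=
  (hT.2.1 α hα.1).1 ⟨t, ZFSet.mem_sep.2 ⟨ht, hα⟩⟩

/-- `(N, ∈)` satisfies that `h : T → κ` is the height function of the tree `(T, R)`. -/
def IsHeightFunctionIn (N : Set ZFSet.{u}) (h T R κ : ZFSet.{u}) : Prop :=
  IsFunctionIn N h T κ ∧ ∀ t ∈ N, t ∈ T → ∀ ξ ∈ N, ξ ∈ κ →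
    ((∃ α ∈ N, PairMemIn N h t α ∧ ξ ∈ α) ↔
      ∃ s ∈ N, s ∈ T ∧ PairMemIn N R s t ∧ PairMemIn N h s ξ)

instance {α : Type} (i j k l : α) : FirstOrderDefinable
    (fun N (v : α → ZFSet.{u}) => IsHeightFunctionIn N (v i) (v j) (v k) (v l)) := by
  unfold IsHeightFunctionIn; infer_instance

theorem IsPowerful.isHeightFunctionIn_iff (hH : IsPowerful H) {h : ZFSet.{u}} (hh : h ∈ H)
    (hT : T ∈ H) (hR : R ∈ H) (hκ : κ ∈ H) : IsHeightFunctionIn H h T R κ ↔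
      ZFSet.IsFunc T κ h ∧ ∀ t ∈ T, ∀ ξ ∈ κ, ((∃ α, ZFSet.pair t α ∈ h ∧ ξ ∈ α) ↔
        ∃ s ∈ T, ZFSet.pair s t ∈ R ∧ ZFSet.pair s ξ ∈ h) := by
  rw [IsHeightFunctionIn, hH.isFunctionIn_iff hh hT hκ]
  have key : ∀ t ∈ H, ∀ ξ ∈ H, (((∃ α ∈ H, PairMemIn H h t α ∧ ξ ∈ α) ↔
      ∃ s ∈ H, s ∈ T ∧ PairMemIn H R s t ∧ PairMemIn H h s ξ) ↔
      ((∃ α, ZFSet.pair t α ∈ h ∧ ξ ∈ α) ↔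
        ∃ s ∈ T, ZFSet.pair s t ∈ R ∧ ZFSet.pair s ξ ∈ h)) := by
    intro t ht ξ hξ
    refine iff_congr ⟨?_, ?_⟩ ⟨?_, ?_⟩
    · rintro ⟨α, hα, hp, hm⟩
      exact ⟨α, (hH.pairMemIn_iff hh ht hα).1 hp, hm⟩
    · rintro ⟨α, hp, hm⟩
      have hα := (hH.of_pair_mem (hH.transitive h hh _ hp)).2
      exact ⟨α, hα, (hH.pairMemIn_iff hh ht hα).2 hp, hm⟩
    · rintro ⟨s, hs, hsT, h₁, h₂⟩
      exact ⟨s, hsT, (hH.pairMemIn_iff hR hs ht).1 h₁, (hH.pairMemIn_iff hh hs hξ).1 h₂⟩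
    · rintro ⟨s, hsT, h₁, h₂⟩
      have hs := hH.transitive T hT s hsT
      exact ⟨s, hs, hsT, (hH.pairMemIn_iff hR hs ht).2 h₁, (hH.pairMemIn_iff hh hs hξ).2 h₂⟩
  refine and_congr_right fun _ => ⟨fun h' t ht ξ hξ => ?_, fun h' t htH ht ξ hξH hξ => ?_⟩
  · have htH := hH.transitive T hT t ht
    have hξH := hH.transitive κ hκ ξ hξ
    exact (key t htH ξ hξH).1 (h' t htH ht ξ hξH hξ)
  · exact (key t htH ξ hξH).2 (h' t ht ξ hξ)

/-- The height function of a tree in `M` is in `M`. -/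
theorem IsElementarySubmodel.exists_heightFunction (hM : IsElementarySubmodel M H)
    (hH : IsPowerful H) (hT : IsKappaTree κ T R) (hTM : T ∈ M) (hRM : R ∈ M) (hκM : κ ∈ M)
    (hκ : κ.IsOrdinal) :
    ∃ h ∈ M, ∀ t α, ZFSet.pair t α ∈ h ↔ t ∈ T ∧ HasHeight T R t α := by
  have hTH := hM.subset hTM
  have hRH := hM.subset hRM
  have hκH := hM.subset hκM
  obtain ⟨h, hhM, hh⟩ : ∃ h ∈ M, IsHeightFunctionIn H h T R κ := by
    -- The recursion avoids isomorphisms and is first-order: it has a solution in `H`, hence one in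
    -- `M`, and its solution is unique.
    refine hM.exists_mem₃ IsHeightFunctionIn hTM hRM hκM ?_
    choose! g hg using fun t (ht : t ∈ T) => hT.1.exists_hasHeight ht
    have hgr : ZFSet.IsFunc T κ (graphOn g T κ) :=
      isFunc_graphOn fun t ht => hT.height_mem ht (hg t ht)
    have hgrH := hH.func_mem hTH hκH hgr
    refine ⟨_, hgrH, (hH.isHeightFunctionIn_iff hgrH hTH hRH hκH).2 ⟨hgr, fun t ht ξ hξ => ?_⟩⟩
    have h₁ : (∃ α, ZFSet.pair t α ∈ graphOn g T κ ∧ ξ ∈ α) ↔ ξ ∈ g t := by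
      constructor
      · rintro ⟨α, hα, hm⟩
        exact (pair_mem_graphOn.1 hα).2.2 ▸ hm
      · intro hm
        exact ⟨g t, pair_mem_graphOn.2 ⟨ht, hT.height_mem ht (hg t ht), rfl⟩, hm⟩
    rw [h₁, (hg t ht).mem_iff hT.1 ht]
    refine exists_congr fun s => and_congr_right fun hs => and_congr_right fun _ => ?_
    rw [pair_mem_graphOn]
    exact ⟨fun h => ⟨hs, hξ, h.unique (hg s hs)⟩, fun h => h.2.2 ▸ hg s hs⟩
  obtain ⟨hfun, hrec⟩ := (hH.isHeightFunctionIn_iff (hM.subset hhM) hTH hRH hκH).1 hh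
  refine ⟨h, hhM, ?_⟩
  choose! g hg huniq using hfun.2
  have hgκ : ∀ t ∈ T, g t ∈ κ := fun t ht => (ZFSet.pair_mem_prod.1 (hfun.1 (hg t ht))).2
  have hrec' : ∀ t ∈ T, ∀ ξ, ξ ∈ g t ↔ ∃ s ∈ T, ZFSet.pair s t ∈ R ∧ g s = ξ := by
    intro t ht ξ
    constructor
    · intro hξ
      obtain ⟨s, hs, hst, hp⟩ :=
        (hrec t ht ξ (hκ.mem_trans hξ (hgκ t ht))).1 ⟨g t, hg t ht, hξ⟩
      exact ⟨s, hs, hst, (huniq s hs ξ hp).symm⟩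
    · rintro ⟨s, hs, hst, rfl⟩
      obtain ⟨α, hα, hm⟩ := (hrec t ht _ (hgκ s hs)).2 ⟨s, hs, hst, hg s hs⟩
      exact huniq t ht α hα ▸ hm
  intro t α
  constructor
  · intro hp
    have ht := (ZFSet.pair_mem_prod.1 (hfun.1 hp)).1
    exact ⟨ht, (hasHeight_iff_of_recursion hT.1 hrec' ht α).2 (huniq t ht α hp).symm⟩
  · rintro ⟨ht, hα⟩
    exact (hasHeight_iff_of_recursion hT.1 hrec' ht α).1 hα ▸ hg t ht

/-- The witness is the initial ordinal of `|a|`; it lies below `κ` even if `κ` is not a cardinal. -/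
theorem cardLTIn_of_card_lt (hH : IsPowerful H) (hκ : κ.IsOrdinal) (hκH : κ ∈ H) {a : ZFSet.{u}}
    (ha : a ∈ H) (h : a.card < κ.card) : CardLTIn H a κ := by
  have hβ : a.card.ord.toZFSet ∈ κ := by
    rw [← hκ.toZFSet_rank_eq] at h ⊢
    rw [Ordinal.card_toZFSet] at h
    rw [Ordinal.toZFSet_mem_toZFSet_iff]
    by_contra hn
    have := Ordinal.card_le_card (not_lt.1 hn)
    rw [Cardinal.card_ord] at this
    exact absurd h (not_lt.2 this)
  obtain ⟨g, hg, hinj⟩ := exists_injOn_of_card_le (a := a) (b := a.card.ord.toZFSet) (by simp)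
  have hβH := hH.transitive κ hκH _ hβ
  exact ⟨_, hβH, hβ, hH.exists_isInjectionIn ha hβH hg hinj⟩

/-- Levels of a tree in `M` with index in `M` are subsets of `M`. -/
theorem IsKappa.mem_of_hasHeight (hκ : IsKappa M κ) (hM : IsElementarySubmodel M H)
    (hH : IsPowerful H) (hT : IsKappaTree κ T R) {h : ZFSet.{u}} (hh : h ∈ M) (hTH : T ∈ H)
    (hspec : ∀ t α, ZFSet.pair t α ∈ h ↔ t ∈ T ∧ HasHeight T R t α) {α t : ZFSet.{u}} (hα : α ∈ M)
    (ht : t ∈ T) (htα : HasHeight T R t α) : t ∈ M := by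
  have hL : level T R α ∈ H := hH.subset_mem hTH ZFSet.sep_subset
  have key : ∀ t ∈ H, PairMemIn H h t α ↔ t ∈ level T R α := fun t ht => by
    rw [hH.pairMemIn_iff (hM.subset hh) ht (hM.subset hα), hspec, level, ZFSet.mem_sep]
  -- The level is definable from `h` and `α`, so it belongs to `M`.
  obtain ⟨L, hLM, hLs⟩ := hM.exists_mem₂
    (fun N L h α => ∀ t ∈ N, t ∈ L ↔ PairMemIn N h t α) hh hα
    ⟨level T R α, hL, fun t ht => (key t ht).symm⟩
  obtain rfl : L = level T R α := by
    ext t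
    constructor
    · intro ht
      have htH := hH.transitive L (hM.subset hLM) t ht
      exact (key t htH).1 ((hLs t htH).1 ht)
    · intro ht
      have htH := hH.transitive _ hL t ht
      exact (hLs t htH).2 ((key t htH).2 ht)
  exact hκ.subset_of_cardLTIn hM hH hLM (cardLTIn_of_card_lt hH hκ.1.2.1 (hM.subset hκ.1.1) hL
    (hT.2.2 α (hT.height_mem ht htα))) t (ZFSet.mem_sep.2 ⟨ht, htα⟩)

/-- `(N, ∈)` satisfies that `b` is a cofinal branch of `(T, R)`, whose height function is `h`. -/
def IsCofinalBranchIn (N : Set ZFSet.{u}) (b T R κ h : ZFSet.{u}) : Prop :=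
  (∀ s ∈ N, s ∈ b → s ∈ T) ∧
  (∀ s ∈ N, s ∈ b → ∀ r ∈ N, r ∈ b → s = r ∨ PairMemIn N R s r ∨ PairMemIn N R r s) ∧
  (∀ s ∈ N, s ∈ b → ∀ r ∈ N, r ∈ T → PairMemIn N R r s → r ∈ b) ∧
  ∀ α ∈ N, α ∈ κ → ∃ s ∈ N, s ∈ b ∧ PairMemIn N h s α

instance {α : Type} (i j k l m : α) : FirstOrderDefinable
    (fun N (v : α → ZFSet.{u}) => IsCofinalBranchIn N (v i) (v j) (v k) (v l) (v m)) := by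
  unfold IsCofinalBranchIn; infer_instance

theorem IsPowerful.isCofinalBranch (hH : IsPowerful H) {b h : ZFSet.{u}} (hb : b ∈ H) (hT : T ∈ H)
    (hR : R ∈ H) (hκ : κ ∈ H) (hh : h ∈ H)
    (hspec : ∀ t α, ZFSet.pair t α ∈ h ↔ t ∈ T ∧ HasHeight T R t α)
    (h' : IsCofinalBranchIn H b T R κ h) : IsCofinalBranch κ T R b := by
  obtain ⟨h₁, h₂, h₃, h₄⟩ := h'
  have hbH := hH.transitive b hb
  refine ⟨fun s hs => h₁ s (hbH s hs) hs, fun s hs r hr => ?_, fun t ht s hs hst => ?_,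
    fun α hα => ?_⟩
  · rw [← hH.pairMemIn_iff hR (hbH s hs) (hbH r hr), ← hH.pairMemIn_iff hR (hbH r hr) (hbH s hs)]
    exact h₂ s (hbH s hs) hs r (hbH r hr) hr
  · have hsH := hH.transitive T hT s hs
    exact h₃ t (hbH t ht) ht s hsH hs ((hH.pairMemIn_iff hR hsH (hbH t ht)).2 hst)
  · have hαH := hH.transitive κ hκ α hα
    obtain ⟨s, hsH, hs, hp⟩ := h₄ α hαH hα
    exact ⟨s, hs, ZFSet.mem_sep.2 ((hspec s α).1 ((hH.pairMemIn_iff hh hsH hαH).1 hp))⟩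

/-- A `κ_M`-guessing model contains no `κ_M`-Aronszajn tree. -/
theorem IsKappa.not_isAronszajnTree (hκ : IsKappa M κ) (hM : IsElementarySubmodel M H)
    (hH : IsPowerful H) (hreg : IsRegularCardinalIn H κ) (hG : HasGuessingProperty M κ)
    (hTR : ZFSet.pair T R ∈ M) : ¬ IsAronszajnTree κ T R := by
  rintro ⟨hT, hno⟩
  obtain ⟨hTM, hRM⟩ := hM.of_pair_mem hH hTR
  have hκM := hκ.1.1
  have hκo := hκ.1.2.1
  have hTH := hM.subset hTM
  have hRH := hM.subset hRM
  have hκH := hM.subset hκM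
  obtain ⟨h, hhM, hspec⟩ := hM.exists_heightFunction hH hT hTM hRM hκM hκo
  have hhH := hM.subset hhM
  obtain ⟨η, hη, hηM⟩ := Set.not_subset.1 hκ.1.2.2
  obtain ⟨t, ht⟩ := (hT.2.1 η (hκo.mem hη)).2 hη
  obtain ⟨ht, htη⟩ := ZFSet.mem_sep.1 ht
  have hmem : ∀ α ∈ M, α ∈ κ → α ∈ η := fun α hα hακ => by
    rcases (hκo.mem hακ).mem_trichotomous (hκo.mem hη) with h' | rfl | h'
    · exact h'
    · exact absurd hα hηM
    · exact absurd (hκ.subset_of_mem hα hακ η h') hηM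
  have hpred : ∀ α ∈ M, α ∈ κ →
      ∃ s ∈ M, s ∈ T ∧ ZFSet.pair s t ∈ R ∧ HasHeight T R s α := fun α hα hακ => by
    obtain ⟨s, hs, hst, hsα⟩ := (htη.mem_iff hT.1 ht α).1 (hmem α hα hακ)
    exact ⟨s, hκ.mem_of_hasHeight hM hH hT hhM hTH hspec hα hs hsα, hs, hst, hsα⟩
  have happrox : IsApproximatedIn M κ (T.sep fun s => ZFSet.pair s t ∈ R) := by
    intro a ha hacard
    have haH := hM.subset ha
    have haκ := (hM.cardLTIn_iff ha hκM).1 hacard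
    choose! g hg using fun t (ht : t ∈ T) => hT.1.exists_hasHeight ht
    -- The set `a` may contain non-nodes, so only heights of its nodes are bounded. This bound need
    -- not be in `M`; it is then replaced by one that is.
    obtain ⟨γ, hγ, hγb⟩ := hreg.exists_bound hH hκH haκ haH g (s := {s | s ∈ T})
      fun s _ hs => hT.height_mem hs (hg s hs)
    obtain ⟨γ, hγM, hγ, hγb⟩ := hM.exists_mem₃
      (fun N γ κ a h => γ ∈ κ ∧ ∀ s ∈ N, s ∈ a → ∀ ξ ∈ N, PairMemIn N h s ξ → ξ ∈ γ)
      hκM ha hhM ⟨γ, hH.transitive κ hκH γ hγ, hγ, fun s hsH hs ξ hξH hp => by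
        obtain ⟨hsT, hsξ⟩ := (hspec s ξ).1 ((hH.pairMemIn_iff hhH hsH hξH).1 hp)
        exact hsξ.unique (hg s hsT) ▸ hγb s hs hsT⟩
    obtain ⟨r, hrM, hr, hrt, hrγ⟩ := hpred γ hγM hγ
    -- Nodes of `a` have height below `γ`, so those below `t` are exactly those below `r`.
    have key : ∀ s ∈ H, s ∈ (T.sep fun s => ZFSet.pair s t ∈ R) ∩ a ↔
        s ∈ a ∧ PairMemIn H R s r := by
      intro s hsH
      rw [hH.pairMemIn_iff hRH hsH (hM.subset hrM), ZFSet.mem_inter, ZFSet.mem_sep]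
      constructor
      · rintro ⟨⟨hs, hst⟩, hsa⟩
        have hgH := hH.transitive κ hκH _ (hT.height_mem hs (hg s hs))
        exact ⟨hsa, hT.1.pair_mem_of_height_mem hs hr ht hst hrt (hg s hs) hrγ
          (hγb s hsH hsa _ hgH ((hH.pairMemIn_iff hhH hsH hgH).2 ((hspec _ _).2 ⟨hs, hg s hs⟩)))⟩
      · rintro ⟨hsa, hsr⟩
        have hs := (ZFSet.pair_mem_prod.1 (hT.1.subset_prod hsr)).1
        exact ⟨⟨hs, hT.1.trans s hs r hr t ht hsr hrt⟩, hsa⟩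
    have hxaH : (T.sep fun s => ZFSet.pair s t ∈ R) ∩ a ∈ H :=
      hH.subset_mem haH fun z hz => (ZFSet.mem_inter.1 hz).2
    obtain ⟨y, hyM, hy⟩ := hM.exists_mem₃
      (fun N y a R r => ∀ s ∈ N, s ∈ y ↔ s ∈ a ∧ PairMemIn N R s r) ha hRM hrM ⟨_, hxaH, key⟩
    convert hyM
    ext s
    constructor
    · intro hs
      have hsH := hH.transitive _ hxaH s hs
      exact (hy s hsH).2 ((key s hsH).1 hs)
    · intro hs
      have hsH := hH.transitive y (hM.subset hyM) s hs
      exact (key s hsH).2 ((hy s hsH).1 hs)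
  obtain ⟨b, hbM, hb⟩ := hG _ ⟨T, hTM, ZFSet.sep_subset⟩ happrox
  have hb' : ∀ s ∈ M, s ∈ b ↔ s ∈ T ∧ ZFSet.pair s t ∈ R := fun s hs => by
    have := Set.ext_iff.1 hb s
    simpa [hs] using this
  -- `M` only sees levels with index in `M ∩ κ`, and there `b_t` has nodes in `M`.
  have hbr : IsCofinalBranchIn M b T R κ h := by
    refine ⟨fun s hsM hs => ((hb' s hsM).1 hs).1, fun s hsM hs r hrM hr => ?_,
      fun s hsM hs r hrM hr hrs => ?_, fun α hαM hα => ?_⟩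
    · rw [hM.pairMemIn_iff hH hRM hsM hrM, hM.pairMemIn_iff hH hRM hrM hsM]
      obtain ⟨hs, hst⟩ := (hb' s hsM).1 hs
      obtain ⟨hr, hrt⟩ := (hb' r hrM).1 hr
      have := hT.1.wellOrder t ht
      rcases trichotomous_of (fun a b : Below T R t => ZFSet.pair a.1 b.1 ∈ R)
        ⟨s, hs, hst⟩ ⟨r, hr, hrt⟩ with h' | h' | h'
      · exact Or.inr (Or.inl h')
      · exact Or.inl (congrArg Subtype.val h')
      · exact Or.inr (Or.inr h')
    · rw [hM.pairMemIn_iff hH hRM hrM hsM] at hrs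
      obtain ⟨hs, hst⟩ := (hb' s hsM).1 hs
      exact (hb' r hrM).2 ⟨hr, hT.1.trans r hr s hs t ht hrs hst⟩
    · obtain ⟨s, hsM, hs, hst, hsα⟩ := hpred α hαM hα
      exact ⟨s, hsM, (hb' s hsM).2 ⟨hs, hst⟩,
        (hM.pairMemIn_iff hH hhM hsM hαM).2 ((hspec s α).2 ⟨hs, hsα⟩)⟩
  exact hno ⟨b, hH.isCofinalBranch (hM.subset hbM) hTH hRH hκH hhH hspec
    ((hM.iff₅ IsCofinalBranchIn hbM hTM hRM hκM hhM).1 hbr)⟩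


/-! ### The tree property from guessing models -/

theorem isRegularCardinalIn_of_isRegular (hH : IsPowerful H) {δ : Cardinal.{u}} (hδ : δ.IsRegular)
    (hδH : δ.ord.toZFSet ∈ H) : IsRegularCardinalIn H δ.ord.toZFSet := by
  have hord := ZFSet.isOrdinal_toZFSet δ.ord
  have hlim : Order.IsSuccLimit δ.ord := Cardinal.isSuccLimit_ord hδ.aleph0_le
  have hmemH : ∀ b < δ.ord, b.toZFSet ∈ H := fun b hb =>
    hH.transitive _ hδH _ (Ordinal.toZFSet_mem_toZFSet_iff.2 hb)
  refine ⟨⟨fun y _ hy z _ hz => hord.mem_trans hz hy, fun y _ hy z _ hz w _ hw =>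
    (hord.mem hy).mem_trans hw hz⟩, ?_, ?_, ?_, ?_⟩
  · exact ⟨_, hmemH 0 hδ.ord_pos, Ordinal.toZFSet_mem_toZFSet_iff.2 hδ.ord_pos⟩
  · rintro β - hβ
    obtain ⟨b, hb, rfl⟩ := Ordinal.mem_toZFSet_iff.1 hβ
    have hs := hlim.succ_lt hb
    exact ⟨_, hmemH _ hs, Ordinal.toZFSet_mem_toZFSet_iff.2 hs,
      Ordinal.toZFSet_mem_toZFSet_iff.2 (Order.lt_succ b)⟩
  · rintro ⟨β, hβH, hβ, f, hf, hinj⟩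
    obtain ⟨b, hb, rfl⟩ := Ordinal.mem_toZFSet_iff.1 hβ
    obtain ⟨hfun, hinj'⟩ := (hH.isInjectionIn_iff hf hδH hβH).1 hinj
    choose! g hg _ using hfun.2
    have hle := card_le_of_injOn g (fun x hx => (ZFSet.pair_mem_prod.1 (hfun.1 (hg x hx))).2)
      fun x hx y hy hxy => hinj' x y (g x) (hg x hx) (hxy ▸ hg y hy)
    rw [Ordinal.card_toZFSet, Ordinal.card_toZFSet, Cardinal.card_ord] at hle
    exact absurd (Cardinal.lt_ord.1 hb) (not_lt.2 hle)
  · intro β hβH hβ f hf hfun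
    obtain ⟨b, hb, rfl⟩ := Ordinal.mem_toZFSet_iff.1 hβ
    have hfun' := (hH.isFunctionIn_iff hf hβH hδH).1 hfun
    choose! g hg huniq using hfun'.2
    let ι := Shrink.{u} b.toZFSet
    let r : ι → Ordinal.{u} := fun i => (g ((equivShrink _).symm i).1).rank
    have hr : ∀ i, r i < δ.ord := fun i => by
      have := ZFSet.rank_lt_of_mem
        (ZFSet.pair_mem_prod.1 (hfun'.1 (hg _ ((equivShrink b.toZFSet).symm i).2))).2
      rwa [Ordinal.rank_toZFSet] at this
    have hι : #ι < δ := by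
      change b.toZFSet.card < δ
      rw [Ordinal.card_toZFSet]
      exact Cardinal.lt_ord.1 hb
    -- The successor of the supremum makes the bound strict.
    have hs := hlim.succ_lt (Ordinal.iSup_lt_of_lt_cof (hδ.cof_ord.symm ▸ hι) hr)
    refine ⟨_, hmemH _ hs, Ordinal.toZFSet_mem_toZFSet_iff.2 hs, fun x hx y hy hp => ?_⟩
    have hp := (hH.pairMemIn_iff hf hx hy).1 hp
    obtain ⟨hxb, hyδ⟩ := ZFSet.pair_mem_prod.1 (hfun'.1 hp)
    obtain rfl := huniq x hxb y hp
    rw [← (hord.mem hyδ).toZFSet_rank_eq, Ordinal.toZFSet_mem_toZFSet_iff, Order.lt_succ_iff]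
    have := Ordinal.le_iSup r (equivShrink _ ⟨x, hxb⟩)
    simpa only [r, Equiv.symm_apply_apply] using this

/-- `GMP(κ, δ)` gives small `δ`-guessing models which contain a given small set. -/
theorem GMP.exists_model {κ δ : Cardinal.{u}} (h : GMP κ δ) (a : ZFSet.{u}) (ha : a.card < κ) :
    ∃ M : Set ZFSet.{u}, (∀ x ∈ a, x ∈ M) ∧ #M < Cardinal.lift.{u + 1} κ ∧
      IsGuessingElementarySubmodel M δ.ord.toZFSet := by
  obtain ⟨θ₀, h⟩ := h
  let t := ZFSet.vonNeumann a.rank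
  let μ := max θ₀ (max ℵ₀ t.card)
  obtain ⟨-, hF⟩ := h (Order.succ μ) ((le_max_left _ _).trans (Order.le_succ _))
    (Cardinal.isRegular_succ ((le_max_left _ _).trans (le_max_right _ _)))
  have haH : ∀ x ∈ a, x ∈ hereditary (Order.succ μ) := fun x hx =>
    ⟨t, ZFSet.isTransitive_vonNeumann _,
      (ZFSet.isTransitive_vonNeumann _).subset_of_mem (ZFSet.subset_vonNeumann.2 le_rfl hx),
      Order.lt_succ_iff.2 ((le_max_right _ _).trans (le_max_right _ _))⟩
  -- For the constant function with value `a`, closure at `∅` already gives `a ⊆ M`.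
  obtain ⟨M, ⟨⟨-, hM⟩, -, hG⟩, hMF⟩ := hF (fun _ => (a : Set ZFSet.{u})) fun _ _ =>
    ⟨haH, by
      have := ZFSet.cardinalMk_coe_sort (x := a)
      exact this.trans_lt (Cardinal.lift_lt.2 ha)⟩
  refine ⟨M, fun x hx => hMF ∅ ⟨Set.empty_subset _, ?_⟩ hx, hM, hG⟩
  simp [Cardinal.aleph0_pos]

theorem not_toZFSet_ord_subset {κ : Cardinal.{u}} (hM : #M < Cardinal.lift.{u + 1} κ) :
    ¬ (κ.ord.toZFSet : Set ZFSet.{u}) ⊆ M := by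
  intro h
  have h₁ := Cardinal.mk_le_mk_of_subset h
  have h₂ := ZFSet.cardinalMk_coe_sort (x := κ.ord.toZFSet)
  rw [Ordinal.card_toZFSet, Cardinal.card_ord] at h₂
  exact absurd (h₂.symm.le.trans h₁) (not_le.2 hM)

/-- Guessing gives `δ ≤ κ_M`; since `|M| < δ` and `δ ∈ M`, also `κ_M ≤ δ`. -/
theorem GMP.treeProperty_self {δ : Cardinal.{u}} (hδ : δ.IsRegular) (h : GMP δ δ) :
    TreeProperty δ := by
  rintro ⟨T, R, hTR⟩
  obtain ⟨M, hTRM, hM, ⟨κ, hκ, hδκ⟩, hδM, hreg, ⟨H, hH, hMH⟩, hG⟩ :=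
    h.exists_model {ZFSet.pair T R} (by
      rw [ZFSet.card_singleton]
      exact Cardinal.one_lt_aleph0.trans_le hδ.aleph0_le)
  obtain rfl : κ = δ.ord.toZFSet := (hκ.2 _ hδM (ZFSet.isOrdinal_toZFSet _)
    (not_toZFSet_ord_subset hM)).antisymm hδκ
  exact hκ.not_isAronszajnTree hMH hH ((hMH.isRegularCardinalIn_iff hδM).1 hreg) hG
    (hTRM _ (ZFSet.mem_singleton.2 rfl)) hTR

/-- Take `M` with `δ ⊆ M` and `δ⁺ ∈ M`. Ordinals of `M` below `δ⁺` inject into `δ`, so are subsets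
of `M`, while `|M| < δ⁺`; thus `κ_M = δ⁺`. -/
theorem GMP.treeProperty_succ {δ : Cardinal.{u}} (hδ : δ.IsRegular) (h : GMP (Order.succ δ) δ) :
    TreeProperty (Order.succ δ) := by
  rintro ⟨T, R, hTR⟩
  have hreg := Cardinal.isRegular_succ hδ.aleph0_le
  obtain ⟨M, haM, hM, -, hδM, -, ⟨H, hH, hMH⟩, hG⟩ :=
    h.exists_model (insert (ZFSet.pair T R) (insert (Order.succ δ).ord.toZFSet δ.ord.toZFSet)) (by
      have h1 : (1 : Cardinal.{u}) < Order.succ δ :=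
        Cardinal.one_lt_aleph0.trans_le hreg.aleph0_le
      refine ZFSet.card_insert_le.trans_lt (Cardinal.add_lt_of_lt hreg.aleph0_le
        (ZFSet.card_insert_le.trans_lt (Cardinal.add_lt_of_lt hreg.aleph0_le ?_ h1)) h1)
      rw [Ordinal.card_toZFSet, Cardinal.card_ord]
      exact Order.lt_succ δ)
  simp only [ZFSet.mem_insert_iff, forall_eq_or_imp] at haM
  obtain ⟨hTRM, hκM, hδsub⟩ := haM
  have hκ : IsKappa M (Order.succ δ).ord.toZFSet := by
    refine ⟨⟨hκM, ZFSet.isOrdinal_toZFSet _, not_toZFSet_ord_subset hM⟩, fun α hα hαo hαM => ?_⟩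
    rcases hαo.mem_or_subset (ZFSet.isOrdinal_toZFSet (Order.succ δ).ord) with h' | h'
    · refine absurd (fun x hx => ?_) hαM
      obtain ⟨b, hb, rfl⟩ := Ordinal.mem_toZFSet_iff.1 h'
      obtain ⟨g, hg, hinj⟩ := exists_injOn_of_card_le (a := b.toZFSet) (b := δ.ord.toZFSet) (by
        rw [Ordinal.card_toZFSet, Ordinal.card_toZFSet, Cardinal.card_ord]
        exact Order.lt_succ_iff.1 (Cardinal.lt_ord.1 hb))
      exact hMH.subset_of_injection hH hα hδM hδsub
        (hH.exists_isInjectionIn (hMH.subset hα) (hMH.subset hδM) hg hinj) x hx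
    · exact h'
  refine hκ.not_isAronszajnTree hMH hH
    (isRegularCardinalIn_of_isRegular hH hreg (hMH.subset hκM)) (fun x hx happ => hG x hx ?_)
    hTRM hTR
  -- Size less than `δ` in `M` implies size less than `δ⁺` in `M`, with the same `β`.
  rintro a ha ⟨β, hβM, hβ, hinj⟩
  exact happ a ha ⟨β, hβM, Ordinal.toZFSet_monotone
    (Cardinal.ord_le_ord.2 (Order.le_succ δ)) hβ, hinj⟩

end GuessingModels

open GuessingModels in
theorem mainTheorem12 :
    (∀ (M : Set ZFSet.{u}) (κ : ZFSet.{u}), IsKappa M κ → IsGuessingElementarySubmodel M κ →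
      ¬ ∃ T R : ZFSet.{u}, ZFSet.pair T R ∈ M ∧ IsAronszajnTree κ T R) ∧
    (∀ δ : Cardinal.{u}, δ.IsRegular → GMP δ δ → TreeProperty δ) ∧
    (∀ δ : Cardinal.{u}, δ.IsRegular → GMP (Order.succ δ) δ → TreeProperty (Order.succ δ)) := by
  refine ⟨?_, fun δ hδ h => h.treeProperty_self hδ, fun δ hδ h => h.treeProperty_succ hδ⟩
  rintro M κ hκ ⟨-, hκM, hreg, ⟨H, hH, hMH⟩, hG⟩ ⟨T, R, hTR, hA⟩
  exact hκ.not_isAronszajnTree hMH hH ((hMH.isRegularCardinalIn_iff hκM).1 hreg) hG hTR hA
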